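/- **Theorem (pmf of the tempered space-fractional Skellam process).** Let $\alpha_1,\alpha_2\in(0,1)$ and $\mu_1,\mu_2,\lambda_1,\lambda_2>0$. Let $N_1,N_2$ be independent homogeneous Poisson processes with intensities $\lambda_1,\lambda_2$. Let $D_{\alpha_1,\mu_1},D_{\alpha_2,\mu_2}$ be independent tempered stable subordinators, that is, non-decreasing Lévy processes with values in $[0,\infty)$ and $\mathbb E[e^{-sD_{\alpha_i,\mu_i}(t)}]=e^{-t((s+\mu_i)^{\alpha_i}-\mu_i^{\alpha_i})}$ for $s>0$, and let $(D_{\alpha_1,\mu_1},D_{\alpha_2,\mu_2})$ be independent of $(N_1,N_2)$. Put $$S(t)=N_1(D_{\alpha_1,\mu_1}(t))-N_2(D_{\alpha_2,\mu_2}(t)),\qquad t\ge 0 .$$ Write $${}_1\psi_1\left[\begin{matrix}(a,A)\\(b,B)\end{matrix};z\right]=\sum_{r=0}^{\infty}\frac{\Gamma(a+Ar)}{\Gamma(b+Br)}\frac{z^r}{r!}$$ for the Fox–Wright function, where $1/\Gamma=0$ at the non-positive integers, and for $i=1,2$ and integers $j\ge 0$ consider the series $$A_i(j)=\sum_{m=0}^{\infty}\frac{\mu_i^m\lambda_i^{-m}}{m!}\;{}_1\psi_1\left[\begin{matrix}(1,\alpha_i)\\(1-j-m,\alpha_i)\end{matrix};-\lambda_i^{\alpha_i}t\right].$$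 Fix $t\ge 0$. 1. The series defining the Fox–Wright functions in $A_1(j),A_2(j)$ converge absolutely. For every $j\ge 2$ and $i\in\{1,2\}$, the series $A_i(j)$ converges if and only if $t=0$ or $\mu_i<\lambda_i$. 2. Suppose that $t=0$, or that $\mu_1<\lambda_1$ and $\mu_2<\lambda_2$. Then the series $A_1(j),A_2(j)$ converge absolutely for all $j\ge0$, and for every integer $k\ge 0$ $$\mathbb P(S(t)=k)=\sum_{n=0}^{\infty}\frac{(-1)^{k}}{n!\,(n+k)!}\,e^{t(\mu_1^{\alpha_1}+\mu_2^{\alpha_2})}\,A_1(n+k)\,A_2(n),$$ while for every integer $k<0$ $$\mathbb P(S(t)=k)=\sum_{n=0}^{\infty}\frac{(-1)^{|k|}}{n!\,(n+|k|)!}\,e^{t(\mu_1^{\alpha_1}+\mu_2^{\alpha_2})}\,A_1(n)\,A_2(n+|k|),$$ where the series over $n$ converge absolutely. -/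

import Mathlib

open MeasureTheory ProbabilityTheory Filter Topology
open scoped NNReal Nat

noncomputable section

/-- A real-valued Lévy process indexed by `[0, ∞)`: it starts at `0`, has independent and
stationary increments, and almost all of its paths are right-continuous with left limits. -/
structure IsLevyProcess {Ω : Type*} [MeasurableSpace Ω]
    (X : ℝ≥0 → Ω → ℝ) (P : Measure Ω) : Prop where
  measurable : ∀ t, Measurable (X t)
  start : ∀ᵐ ω ∂P, X 0 ω = 0
  indep_increments : HasIndepIncrements X P
  stationary : ∀ s t, IdentDistrib (fun ω => X (s + t) ω - X s ω) (X t) P P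
  cadlag : ∀ᵐ ω ∂P, ∀ t : ℝ≥0,
    ContinuousWithinAt (fun s => X s ω) (Set.Ici t) t ∧
      ∃ l : ℝ, Tendsto (fun s => X s ω) (𝓝[<] t) (𝓝 l)

/-- A homogeneous Poisson process of intensity `lam`: a counting process which is a Lévy process
and whose value at time `t` has the Poisson distribution with mean `lam * t`. -/
structure IsPoissonProcess {Ω : Type*} [MeasurableSpace Ω]
    (lam : ℝ) (N : ℝ≥0 → Ω → ℕ) (P : Measure Ω) : Prop where
  levy : IsLevyProcess (fun t ω => (N t ω : ℝ)) P
  law : ∀ t, HasLaw (N t) (poissonMeasure (lam.toNNReal * t)) P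

/-- A tempered `α`-stable subordinator with tempering parameter `μ`: a Lévy process with values
in `[0, ∞)` and almost surely non-decreasing paths, whose Laplace exponent is
`s ↦ (s + μ) ^ α - μ ^ α`. -/
structure IsTemperedStableSubordinator {Ω : Type*} [MeasurableSpace Ω]
    (α μ : ℝ) (D : ℝ≥0 → Ω → ℝ≥0) (P : Measure Ω) : Prop where
  levy : IsLevyProcess (fun t ω => (D t ω : ℝ)) P
  monotone : ∀ᵐ ω ∂P, Monotone (fun t => D t ω)
  laplace : ∀ (t : ℝ≥0) (s : ℝ), 0 < s →
    ∫ ω, Real.exp (-s * (D t ω : ℝ)) ∂P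
      = Real.exp (-(t : ℝ) * ((s + μ) ^ α - μ ^ α))

/-- The tempered space-fractional Skellam process `N₁(D₁(t)) - N₂(D₂(t))`. -/
def tsfsp {Ω : Type*} (N₁ N₂ : ℝ≥0 → Ω → ℕ) (D₁ D₂ : ℝ≥0 → Ω → ℝ≥0)
    (t : ℝ≥0) (ω : Ω) : ℤ :=
  (N₁ (D₁ t ω) ω : ℤ) - (N₂ (D₂ t ω) ω : ℤ)

/-- The `r`-th term `Γ(a + A r) / Γ(b + B r) * z ^ r / r!` of the Fox–Wright series.
`Real.Gamma` vanishes at its poles and `x / 0 = 0`, so that `1 / Γ` has its usual value `0` at the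
non-positive integers. -/
def foxWrightTerm (a A b B z : ℝ) (r : ℕ) : ℝ :=
  Real.Gamma (a + A * r) / Real.Gamma (b + B * r) * (z ^ r / (r ! : ℝ))

/-- The Fox–Wright function `₁ψ₁[(a, A); (b, B); z]`. -/
def foxWright (a A b B z : ℝ) : ℝ :=
  ∑' r : ℕ, foxWrightTerm a A b B z r

/-- The term `μ ^ m * lam ^ (-m) / m! * ₁ψ₁[(1, α); (1 - j - m, α); - lam ^ α * t]`. -/
def innerTerm (α μ lam t : ℝ) (j m : ℕ) : ℝ :=
  μ ^ m * (lam ^ m)⁻¹ / (m ! : ℝ) *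
    foxWright 1 α (1 - (j : ℝ) - (m : ℝ)) α (-lam ^ α * t)

end

open scoped ENNReal

/-! Put `f x = exp (-t * x ^ α)`. As `Γ(1 + αr) / Γ(1 - n + αr)` is the falling factorial of `αr`,
the Fox–Wright value with `n = j + m` is `lam ^ n * f⁽ⁿ⁾(lam)`. So `A(j)` is `lam ^ j` times the
Taylor series of `f⁽ʲ⁾` at `lam`, evaluated at `lam + μ` (`innerTerm_eq`). It converges for `μ <
lam` because `f` is holomorphic on the disc of radius `lam` about `lam`. If it converged with `t >
0` and `μ ≥ lam`, the Taylor coefficients of `f''` would be `O(lam ^ (-p))`, forcing `f'' x = O(1 /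
x)` on `(0, lam)`; but `f''` grows like `x ^ (α - 2)` at `0`. This needs `j ≥ 2`: `x * f' x` stays
bounded. On the probabilistic side, conditioning on the subordinators makes the counts independent
Poisson variables, and `E[D ^ n * exp (-lam * D)]` is, up to sign and `exp (t * μ ^ α)`, `f⁽ⁿ⁾(lam +
μ)` (`integral_pow_mul_exp_neg`, `measure_eval_eq`). The event `S(t) = k` is then split by the
smaller of the two counts. -/

/-! ### Fox–Wright values as derivatives of the stretched exponential. -/

theorem Gamma_one_add_div_Gamma_one_sub_add {x : ℝ} (hx : 0 ≤ x) (n : ℕ) :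
    Real.Gamma (1 + x) / Real.Gamma (1 - n + x) = ∏ i ∈ Finset.range n, (x - i) := by
  induction n with
  | zero => simp [(Real.Gamma_pos_of_pos (by linarith : (0 : ℝ) < 1 + x)).ne']
  | succ n ih =>
    rw [Finset.prod_range_succ, ← ih]
    have e : 1 - ((n + 1 : ℕ) : ℝ) + x = x - n := by push_cast; ring
    have e' : 1 - (n : ℝ) + x = (x - n) + 1 := by ring
    rw [e, e']
    rcases eq_or_ne (x - n) 0 with h | h
    -- At the pole the left side is `0` too, since `Real.Gamma 0 = 0` and `x / 0 = 0`.
    · simp [h]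
    · rw [Real.Gamma_add_one h, div_mul_eq_mul_div, mul_comm (x - n), mul_div_mul_right _ _ h]

/-- The `r`-th term of the `n`-th derivative of the series
`exp (-t * x ^ α) = ∑ r, (-t) ^ r * x ^ (α * r) / r!`. -/
noncomputable def stretchedExpTerm (α t : ℝ) (n r : ℕ) (x : ℝ) : ℝ :=
  (∏ i ∈ Finset.range n, (α * r - i)) * ((-t) ^ r / (r ! : ℝ)) * x ^ (α * r - n)

/-- The stretched exponential function `x ↦ exp (-t * x ^ α)`. -/
noncomputable def stretchedExp (α t x : ℝ) : ℝ := Real.exp (-t * x ^ α)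

theorem hasDerivAt_stretchedExpTerm (α t : ℝ) (n r : ℕ) {x : ℝ} (hx : 0 < x) :
    HasDerivAt (stretchedExpTerm α t n r) (stretchedExpTerm α t (n + 1) r x) x := by
  have h := (Real.hasDerivAt_rpow_const (p := α * r - n) (Or.inl hx.ne')).const_mul
    ((∏ i ∈ Finset.range n, (α * r - i)) * ((-t) ^ r / (r ! : ℝ)))
  refine h.congr_deriv ?_
  have e : α * r - ((n + 1 : ℕ) : ℝ) = α * r - n - 1 := by push_cast; ring
  rw [stretchedExpTerm, Finset.prod_range_succ, e]
  ring

/-- Each factor is at most `r + 1 + i` in absolute value, and these bounds multiply to an ascending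
factorial. -/
theorem abs_prod_range_sub_le {α : ℝ} (h0 : 0 ≤ α) (h1 : α ≤ 1) (n r : ℕ) :
    |∏ i ∈ Finset.range n, (α * r - i)| ≤ n ! * 2 ^ (r + n) := by
  calc |∏ i ∈ Finset.range n, (α * r - i)|
      ≤ ∏ i ∈ Finset.range n, ((r + 1 + i : ℕ) : ℝ) := by
        rw [Finset.abs_prod]
        refine Finset.prod_le_prod (fun _ _ => abs_nonneg _) fun i _ => ?_
        have hr : (0 : ℝ) ≤ r := r.cast_nonneg
        have hi : (0 : ℝ) ≤ i := i.cast_nonneg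
        push_cast
        rw [abs_le]
        constructor <;> nlinarith [mul_nonneg h0 hr]
    _ = ((n ! * (r + n).choose n : ℕ) : ℝ) := by
        rw [← Nat.ascFactorial_eq_factorial_mul_choose, Nat.ascFactorial_eq_prod_range,
          Nat.cast_prod]
    _ ≤ n ! * 2 ^ (r + n) := by
        push_cast
        gcongr
        exact_mod_cast Nat.choose_le_two_pow _ _

theorem rpow_mul_natCast_sub {x : ℝ} (hx : 0 < x) (α : ℝ) (n r : ℕ) :
    x ^ (α * r - n) = (x ^ α) ^ r * (x ^ n)⁻¹ := by
  rw [Real.rpow_sub hx, Real.rpow_mul hx.le, Real.rpow_natCast, Real.rpow_natCast, div_eq_mul_inv]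

/-- Uniformity in `x` on `[δ, R]` is what permits termwise differentiation. -/
theorem norm_stretchedExpTerm_le {α : ℝ} (h0 : 0 ≤ α) (h1 : α ≤ 1) (t : ℝ) (n r : ℕ)
    {x δ R : ℝ} (hδ : 0 < δ) (hx : δ ≤ x) (hR : x ≤ R) :
    ‖stretchedExpTerm α t n r x‖ ≤
      n ! * 2 ^ n * (δ ^ n)⁻¹ * ((2 * |t| * R ^ α) ^ r / (r ! : ℝ)) := by
  have hx0 : 0 < x := hδ.trans_le hx
  have hR0 : 0 < R := hx0.trans_le hR
  have hp := abs_prod_range_sub_le h0 h1 n r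
  rw [stretchedExpTerm, norm_mul, norm_mul, rpow_mul_natCast_sub hx0, norm_mul, Real.norm_eq_abs,
    norm_div, norm_pow, norm_neg, Real.norm_eq_abs t, Real.norm_natCast,
    Real.norm_of_nonneg (by positivity : 0 ≤ (x ^ α) ^ r),
    Real.norm_of_nonneg (by positivity : 0 ≤ (x ^ n)⁻¹)]
  calc |∏ i ∈ Finset.range n, (α * r - i)| * (|t| ^ r / r !) * ((x ^ α) ^ r * (x ^ n)⁻¹)
      ≤ (n ! * 2 ^ (r + n)) * (|t| ^ r / r !) * ((R ^ α) ^ r * (δ ^ n)⁻¹) := by gcongr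
    _ = _ := by rw [mul_pow, mul_pow, pow_add]; ring

theorem summable_stretchedExpTerm {α : ℝ} (h0 : 0 ≤ α) (h1 : α ≤ 1) (t : ℝ) (n : ℕ)
    {x : ℝ} (hx : 0 < x) : Summable fun r => stretchedExpTerm α t n r x :=
  .of_norm_bounded ((Real.summable_pow_div_factorial _).mul_left _)
    fun r => norm_stretchedExpTerm_le h0 h1 t n r hx le_rfl le_rfl

theorem iteratedDeriv_stretchedExp {α : ℝ} (h0 : 0 ≤ α) (h1 : α ≤ 1) (t : ℝ) (n : ℕ)
    {x : ℝ} (hx : 0 < x) :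
    iteratedDeriv n (stretchedExp α t) x = ∑' r, stretchedExpTerm α t n r x := by
  induction n generalizing x with
  | zero =>
    rw [iteratedDeriv_zero, stretchedExp, Real.exp_eq_exp_ℝ, NormedSpace.exp_eq_tsum_div]
    refine tsum_congr fun r => ?_
    rw [stretchedExpTerm, rpow_mul_natCast_sub hx, mul_pow]
    simp
    ring
  | succ n ih =>
    have hev : iteratedDeriv n (stretchedExp α t) =ᶠ[𝓝 x]
        fun y => ∑' r, stretchedExpTerm α t n r y := by
      filter_upwards [lt_mem_nhds hx] with y hy using ih hy
    rw [iteratedDeriv_succ, hev.deriv_eq]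
    have hmem : x ∈ Set.Ioo (x / 2) (2 * x) := ⟨by linarith, by linarith⟩
    exact (hasDerivAt_tsum_of_isPreconnected
      ((Real.summable_pow_div_factorial (2 * |t| * (2 * x) ^ α)).mul_left
        ((n + 1)! * 2 ^ (n + 1) * ((x / 2) ^ (n + 1))⁻¹)) isOpen_Ioo isPreconnected_Ioo
      (fun r y hy => hasDerivAt_stretchedExpTerm α t n r ((half_pos hx).trans hy.1))
      (fun r y hy => norm_stretchedExpTerm_le h0 h1 t (n + 1) r (half_pos hx) hy.1.le hy.2.le)
      hmem (summable_stretchedExpTerm h0 h1 t n hx) hmem).deriv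

theorem foxWrightTerm_eq {α : ℝ} (h0 : 0 ≤ α) (t : ℝ) (j m r : ℕ) {x : ℝ} (hx : 0 < x) :
    foxWrightTerm 1 α (1 - (j : ℝ) - (m : ℝ)) α (-x ^ α * t) r =
      x ^ (j + m) * stretchedExpTerm α t (j + m) r x := by
  have h := Gamma_one_add_div_Gamma_one_sub_add (mul_nonneg h0 r.cast_nonneg) (j + m)
  rw [foxWrightTerm, show (1 : ℝ) - j - m + α * r = 1 - (j + m : ℕ) + α * r by push_cast; ring,
    h, stretchedExpTerm, rpow_mul_natCast_sub hx, show -x ^ α * t = -t * x ^ α by ring, mul_pow]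
  have : x ^ (j + m) ≠ 0 := by positivity
  field_simp

theorem summable_foxWrightTerm {α : ℝ} (h0 : 0 ≤ α) (h1 : α ≤ 1) (t : ℝ) (j m : ℕ)
    {x : ℝ} (hx : 0 < x) :
    Summable (foxWrightTerm 1 α (1 - (j : ℝ) - (m : ℝ)) α (-x ^ α * t)) :=
  ((summable_stretchedExpTerm h0 h1 t (j + m) hx).mul_left _).congr
    fun r => (foxWrightTerm_eq h0 t j m r hx).symm

theorem innerTerm_eq {α : ℝ} (h0 : 0 ≤ α) (h1 : α ≤ 1) (μ t : ℝ) (j m : ℕ)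
    {x : ℝ} (hx : 0 < x) :
    innerTerm α μ x t j m =
      x ^ j * (μ ^ m / (m ! : ℝ) * iteratedDeriv (j + m) (stretchedExp α t) x) := by
  rw [innerTerm, foxWright, tsum_congr fun r => foxWrightTerm_eq h0 t j m r hx, tsum_mul_left,
    iteratedDeriv_stretchedExp h0 h1 t _ hx, pow_add]
  have : x ^ m ≠ 0 := by positivity
  field_simp

/-! ### Taylor expansion and convergence for `μ < lam`. -/

/-- The holomorphic extension of `stretchedExp` to the slit plane. -/
noncomputable def complexStretchedExp (α t : ℝ) (z : ℂ) : ℂ := Complex.exp (-t * z ^ (α : ℂ))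

theorem differentiableOn_complexStretchedExp (α t : ℝ) :
    DifferentiableOn ℂ (complexStretchedExp α t) Complex.slitPlane := fun _ hz =>
  (((differentiableAt_id.cpow_const hz).const_mul _).cexp).differentiableWithinAt

theorem differentiableOn_iteratedDeriv_complexStretchedExp (α t : ℝ) (n : ℕ) :
    DifferentiableOn ℂ (iteratedDeriv n (complexStretchedExp α t)) Complex.slitPlane := by
  induction n with
  | zero => simpa using differentiableOn_complexStretchedExp α t
  | succ n ih => rw [iteratedDeriv_succ]; exact ih.deriv Complex.isOpen_slitPlane

theorem iteratedDeriv_complexStretchedExp_ofReal (α t : ℝ) (n : ℕ) {x : ℝ} (hx : 0 < x) :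
    iteratedDeriv n (complexStretchedExp α t) x = (iteratedDeriv n (stretchedExp α t) x : ℝ) := by
  induction n generalizing x with
  | zero => simp [complexStretchedExp, stretchedExp, Complex.ofReal_cpow hx.le]
  | succ n ih =>
    have hd : HasDerivAt (iteratedDeriv n (complexStretchedExp α t))
        (iteratedDeriv (n + 1) (complexStretchedExp α t) x) x := by
      rw [iteratedDeriv_succ]
      exact ((differentiableOn_iteratedDeriv_complexStretchedExp α t n).differentiableAt
        (Complex.isOpen_slitPlane.mem_nhds (by simpa using hx))).hasDerivAt
    have hev : (fun y : ℝ => iteratedDeriv n (complexStretchedExp α t) y) =ᶠ[𝓝 x]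
        fun y => ((iteratedDeriv n (stretchedExp α t) y : ℝ) : ℂ) := by
      filter_upwards [lt_mem_nhds hx] with y hy using ih hy
    have h1 := hd.comp_ofReal.congr_of_eventuallyEq hev.symm
    have hre := (hd.real_of_complex.congr_of_eventuallyEq
      (hev.fun_comp Complex.re).symm)
    simp only [Function.comp_def, Complex.ofReal_re] at hre
    have h2 : HasDerivAt (fun y => ((iteratedDeriv n (stretchedExp α t) y : ℝ) : ℂ))
      _ x := hre.ofReal_comp
    rw [h1.unique h2, iteratedDeriv_succ (f := stretchedExp α t), hre.deriv]

theorem hasSum_taylorSeries_stretchedExp (α t : ℝ) (j : ℕ) {x h : ℝ} (hh : |h| < x) :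
    HasSum (fun m : ℕ => h ^ m / (m ! : ℝ) * iteratedDeriv (j + m) (stretchedExp α t) x)
      (iteratedDeriv j (stretchedExp α t) (x + h)) := by
  have hx : 0 < x := (abs_nonneg h).trans_lt hh
  have hy : 0 < x + h := by linarith [neg_abs_le h]
  -- The disc of radius `x` about `x` lies in the right half-plane.
  have hsub : Metric.ball (x : ℂ) x ⊆ Complex.slitPlane := fun z hz => by
    refine Or.inl ?_
    have h1 := (Complex.abs_re_le_norm (z - x)).trans_lt (mem_ball_iff_norm.1 hz)
    rw [Complex.sub_re, Complex.ofReal_re] at h1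
    linarith [neg_abs_le (z.re - x)]
  have key := Complex.hasSum_taylorSeries_on_ball
    ((differentiableOn_iteratedDeriv_complexStretchedExp α t j).mono hsub)
    (z := ((x + h : ℝ) : ℂ)) (by
      rw [mem_ball_iff_norm, ← Complex.ofReal_sub, Complex.norm_real]; simpa using hh)
  rw [iteratedDeriv_complexStretchedExp_ofReal α t j hy] at key
  rw [← Complex.hasSum_ofReal]
  refine key.congr_fun fun m => ?_
  have e : iteratedDeriv m (iteratedDeriv j (complexStretchedExp α t))
      = iteratedDeriv (j + m) (complexStretchedExp α t) := by
    rw [iteratedDeriv_eq_iterate, iteratedDeriv_eq_iterate, iteratedDeriv_eq_iterate,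
      ← Function.iterate_add_apply, add_comm]
  rw [e, iteratedDeriv_complexStretchedExp_ofReal α t _ hx]
  push_cast
  simp only [smul_eq_mul, add_sub_cancel_left]
  ring

theorem hasSum_innerTerm {α : ℝ} (h0 : 0 ≤ α) (h1 : α ≤ 1) {μ t lam : ℝ} (hμ : 0 < μ)
    (hlam : 0 < lam) (h : t = 0 ∨ μ < lam) (j : ℕ) :
    HasSum (innerTerm α μ lam t j)
      (lam ^ j * iteratedDeriv j (stretchedExp α t) (lam + μ)) := by
  rw [show innerTerm α μ lam t j = _ from funext fun m => innerTerm_eq h0 h1 μ t j m hlam]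
  refine HasSum.mul_left _ ?_
  rcases h with rfl | h
  · have hc : stretchedExp α 0 = fun _ => 1 := by ext; simp [stretchedExp]
    rw [hc]
    have h := hasSum_single (f := fun m : ℕ => μ ^ m / (m ! : ℝ) *
      iteratedDeriv (j + m) (fun _ : ℝ => (1 : ℝ)) lam) 0 fun m hm => by
        simp [iteratedDeriv_const, hm]
    simpa [iteratedDeriv_const] using h
  · exact hasSum_taylorSeries_stretchedExp α t j (by rwa [abs_of_pos hμ])

/-! ### Divergence for `μ ≥ lam`. -/

theorem iteratedDeriv_two_stretchedExp (α t : ℝ) {x : ℝ} (hx : 0 < x) :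
    iteratedDeriv 2 (stretchedExp α t) x =
      ((t * α * x ^ (α - 1)) ^ 2 + t * α * (1 - α) * x ^ (α - 2)) * stretchedExp α t x := by
  have hd : ∀ y : ℝ, 0 < y → HasDerivAt (stretchedExp α t)
      (stretchedExp α t y * (-t * (α * y ^ (α - 1)))) y := fun y hy =>
    ((Real.hasDerivAt_rpow_const (Or.inl hy.ne')).const_mul (-t)).exp
  have hev : deriv (stretchedExp α t) =ᶠ[𝓝 x]
      fun y => stretchedExp α t y * (-t * (α * y ^ (α - 1))) := by
    filter_upwards [lt_mem_nhds hx] with y hy using (hd y hy).deriv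
  rw [iteratedDeriv_succ, iteratedDeriv_one, hev.deriv_eq]
  have h2 := (hd x hx).mul (((Real.hasDerivAt_rpow_const (p := α - 1)
    (Or.inl hx.ne')).const_mul α).const_mul (-t))
  rw [show (fun y => stretchedExp α t y * (-t * (α * y ^ (α - 1)))) =
    stretchedExp α t * fun y => -t * (α * y ^ (α - 1)) from rfl, h2.deriv,
    show α - 2 = α - 1 - 1 by ring]
  ring

/-- Both summands of the second derivative are nonnegative, so nothing cancels; the one with `x ^ (α
- 2)`, multiplied by `x`, already blows up at `0`. -/
theorem not_mul_abs_iteratedDeriv_two_stretchedExp_bounded {α t : ℝ} (h0 : 0 < α) (h1 : α < 1)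
    (ht : 0 < t) {δ : ℝ} (hδ : 0 < δ) (C : ℝ) :
    ∃ x, 0 < x ∧ x < δ ∧ C < x * |iteratedDeriv 2 (stretchedExp α t) x| := by
  have hlim : Tendsto (fun x : ℝ => t * α * (1 - α) * Real.exp (-t) * x ^ (α - 1)) (𝓝[>] 0)
      atTop := by
    refine Tendsto.const_mul_atTop ?_ (tendsto_rpow_neg_nhdsGT_zero (by linarith))
    have := sub_pos.2 h1
    positivity
  obtain ⟨x, ⟨hC, hx⟩, hxδ, hx1⟩ := ((hlim.eventually_gt_atTop C).and (self_mem_nhdsWithin)).and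
    (((gt_mem_nhds hδ).filter_mono nhdsWithin_le_nhds).and
      ((gt_mem_nhds one_pos).filter_mono nhdsWithin_le_nhds)) |>.exists
  have hx : 0 < x := hx
  have h1' := sub_pos.2 h1
  refine ⟨x, hx, hxδ, hC.trans_le ?_⟩
  have hexp : Real.exp (-t) ≤ stretchedExp α t x := by
    refine Real.exp_le_exp.2 ?_
    have := Real.rpow_le_one hx.le hx1.le h0.le
    nlinarith
  rw [iteratedDeriv_two_stretchedExp α t hx, abs_of_nonneg (by
    have : 0 ≤ stretchedExp α t x := (Real.exp_pos _).le
    positivity)]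
  have e : x ^ (α - 1) = x * x ^ (α - 2) := by
    rw [show α - 1 = 1 + (α - 2) by ring, Real.rpow_add hx, Real.rpow_one]
  calc t * α * (1 - α) * Real.exp (-t) * x ^ (α - 1)
      = x * ((0 + t * α * (1 - α) * x ^ (α - 2)) * Real.exp (-t)) := by rw [e]; ring
    _ ≤ _ := by gcongr; positivity

theorem exists_tendsto_sum_innerTerm_iff {α : ℝ} (h0 : 0 < α) (h1 : α < 1) {μ t lam : ℝ}
    (hμ : 0 < μ) (hlam : 0 < lam) (ht : 0 ≤ t) {j : ℕ} (hj : 2 ≤ j) :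
    (∃ s, Tendsto (fun M => ∑ m ∈ Finset.range M, innerTerm α μ lam t j m) atTop (𝓝 s)) ↔
      t = 0 ∨ μ < lam := by
  refine ⟨fun ⟨s, hs⟩ => ?_, fun h =>
    ⟨_, (hasSum_innerTerm h0.le h1.le hμ hlam h j).tendsto_sum_nat⟩⟩
  by_contra! hcon
  obtain ⟨ht0, hle⟩ := hcon
  have htpos : 0 < t := lt_of_le_of_ne ht (Ne.symm ht0)
  have hzero : Tendsto (innerTerm α μ lam t j) atTop (𝓝 0) := by
    have h := ((tendsto_add_atTop_iff_nat 1).2 hs).sub hs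
    simpa [Finset.sum_range_succ] using h
  obtain ⟨B, hB⟩ := Asymptotics.isBigO_one_nat_atTop_iff.1 (hzero.isBigO_one ℝ)
  -- the Taylor coefficients of the second derivative at `lam` are bounded
  have hbig : (fun p : ℕ => lam ^ p / (p ! : ℝ) * iteratedDeriv (2 + p) (stretchedExp α t) lam)
      =O[atTop] (fun _ => (1 : ℝ)) := by
    -- With `p = j - 2 + m`, the bound `B` on the terms transfers through `lam ^ m ≤ μ ^ m` and `m !
    -- ≤ p !`.
    refine Asymptotics.IsBigO.of_bound (lam ^ (j - 2) * (B / lam ^ j)) ?_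
    filter_upwards [eventually_ge_atTop (j - 2)] with p hp
    obtain ⟨m, rfl⟩ := Nat.exists_eq_add_of_le hp
    have hm := hB m
    rw [innerTerm_eq h0.le h1.le μ t j m hlam, norm_mul, norm_mul,
      Real.norm_of_nonneg (by positivity : 0 ≤ lam ^ j),
      Real.norm_of_nonneg (by positivity : 0 ≤ μ ^ m / (m ! : ℝ))] at hm
    rw [norm_mul, Real.norm_of_nonneg (by positivity : 0 ≤ lam ^ (j - 2 + m) / ((j - 2 + m)! : ℝ)),
      show 2 + (j - 2 + m) = j + m by omega, norm_one, mul_one, pow_add]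
    have hm' : μ ^ m / (m ! : ℝ) * ‖iteratedDeriv (j + m) (stretchedExp α t) lam‖ ≤ B / lam ^ j := by
      rw [le_div_iff₀ (by positivity), mul_comm]; exact hm
    have hfac : (m ! : ℝ) ≤ ((j - 2 + m)! : ℝ) := by
      exact_mod_cast Nat.factorial_le (by omega)
    calc lam ^ (j - 2) * lam ^ m / ((j - 2 + m)! : ℝ) *
          ‖iteratedDeriv (j + m) (stretchedExp α t) lam‖
        ≤ lam ^ (j - 2) * μ ^ m / (m ! : ℝ) *
          ‖iteratedDeriv (j + m) (stretchedExp α t) lam‖ := by gcongr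
      _ = lam ^ (j - 2) * (μ ^ m / (m ! : ℝ) *
          ‖iteratedDeriv (j + m) (stretchedExp α t) lam‖) := by ring
      _ ≤ _ := by gcongr
  obtain ⟨C, hC⟩ := Asymptotics.isBigO_one_nat_atTop_iff.1 hbig
  obtain ⟨x, hx, hxlam, hlt⟩ :=
    not_mul_abs_iteratedDeriv_two_stretchedExp_bounded h0 h1 htpos hlam (C * lam)
  have hρ0 : 0 ≤ 1 - x / lam := sub_nonneg.2 ((div_le_one hlam).2 hxlam.le)
  have hρ1 : 1 - x / lam < 1 := by linarith [div_pos hx hlam]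
  have hT := hasSum_taylorSeries_stretchedExp α t 2 (x := lam) (h := x - lam)
    (by rw [abs_lt]; constructor <;> linarith)
  rw [add_sub_cancel] at hT
  -- Expanding at `lam` and evaluating at `x` gives a geometric majorant of ratio `1 - x / lam`,
  -- with sum `C * lam / x`.
  have hgeo := (hasSum_geometric_of_lt_one hρ0 hρ1).mul_left C
  have hbound := hT.norm_le_of_bounded hgeo fun p => by
    have e : x - lam = -(1 - x / lam) * lam := by field_simp; ring
    have hp := hC p
    rw [norm_mul, norm_div, norm_pow, Real.norm_of_nonneg hlam.le] at hp
    rw [norm_mul, norm_div, norm_pow, e, norm_mul, norm_neg, Real.norm_of_nonneg hρ0,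
      Real.norm_of_nonneg hlam.le, mul_pow, mul_comm C]
    calc _ = (1 - x / lam) ^ p * (lam ^ p / ‖(p ! : ℝ)‖ *
          ‖iteratedDeriv (2 + p) (stretchedExp α t) lam‖) := by ring
      _ ≤ _ := by gcongr
  rw [sub_sub_cancel, Real.norm_eq_abs, inv_div] at hbound
  have : x * |iteratedDeriv 2 (stretchedExp α t) x| ≤ C * lam := by
    calc _ ≤ x * (C * (lam / x)) := by gcongr
      _ = C * lam := by field_simp
  linarith

/-! ### Moments from the Laplace transform, and conditioning on a discrete variable. -/

section Laplace

variable {Ω : Type*} [MeasurableSpace Ω] {P : Measure Ω}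

theorem IsLevyProcess.measurable_natCast {N : ℝ≥0 → Ω → ℕ}
    (h : IsLevyProcess (fun t ω => (N t ω : ℝ)) P) (t : ℝ≥0) : Measurable (N t) :=
  Nat.isClosedEmbedding_coe_real.measurableEmbedding.measurable_comp_iff.1 (h.measurable t)

theorem IsTemperedStableSubordinator.measurable {α μ : ℝ} {D : ℝ≥0 → Ω → ℝ≥0}
    (h : IsTemperedStableSubordinator α μ D P) (t : ℝ≥0) : Measurable (D t) :=
  measurable_coe_nnreal_real_iff.1 (h.levy.measurable t)

theorem IsTemperedStableSubordinator.integral_pow_mul_exp_neg [IsProbabilityMeasure P]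
    {α μ : ℝ} {D : ℝ≥0 → Ω → ℝ≥0} (h : IsTemperedStableSubordinator α μ D P) (t : ℝ≥0)
    {lam : ℝ} (hlam : 0 < lam) (n : ℕ) :
    ∫ ω, (D t ω : ℝ) ^ n * Real.exp (-lam * D t ω) ∂P =
      (-1) ^ n * Real.exp (t * μ ^ α) * iteratedDeriv n (stretchedExp α t) (lam + μ) := by
  have hsub : Set.Iio 0 ⊆ integrableExpSet (fun ω => (D t ω : ℝ)) P := fun v hv => by
    refine Integrable.of_bound (C := 1)
      (((h.levy.measurable t).const_mul v).exp.aestronglyMeasurable) (ae_of_all _ fun ω => ?_)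
    rw [Real.norm_of_nonneg (Real.exp_pos _).le]
    exact Real.exp_le_one_iff.2 (mul_nonpos_of_nonpos_of_nonneg (le_of_lt hv) (D t ω).2)
  have hint : -lam ∈ interior (integrableExpSet (fun ω => (D t ω : ℝ)) P) :=
    interior_maximal hsub isOpen_Iio (neg_lt_zero.2 hlam)
  have hev : mgf (fun ω => (D t ω : ℝ)) P =ᶠ[𝓝 (-lam)]
      fun v => Real.exp (t * μ ^ α) * stretchedExp α t (μ - v) := by
    filter_upwards [gt_mem_nhds (neg_lt_zero.2 hlam)] with v hv
    have hl := h.laplace t (-v) (neg_pos.2 hv)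
    rw [neg_neg] at hl
    rw [mgf, hl, stretchedExp, ← Real.exp_add, neg_add_eq_sub]
    congr 1
    ring
  have key := iteratedDeriv_mgf hint n
  rw [hev.iteratedDeriv_eq, iteratedDeriv_const_mul_field, iteratedDeriv_comp_const_sub] at key
  rw [← key]
  simp only [sub_neg_eq_add, add_comm μ, smul_eq_mul]
  ring

/-- Countability of `ι` makes the joint event measurable, although `β` will be a space of paths with
the product σ-algebra. -/
theorem measure_mem_of_indepFun [IsProbabilityMeasure P] {β ι : Type*} [MeasurableSpace β]
    [Countable ι] [MeasurableSpace ι] [MeasurableSingletonClass ι] {Y : Ω → β} {T : Ω → ι}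
    (hY : Measurable Y) (hT : Measurable T) (h : IndepFun Y T P) {E : ι → Set β}
    (hE : ∀ i, MeasurableSet (E i)) :
    P {ω | Y ω ∈ E (T ω)} = ∫⁻ ω, P {ω' | Y ω' ∈ E (T ω)} ∂P := by
  have hmeas : MeasurableSet {p : β × ι | p.1 ∈ E p.2} := by
    have : {p : β × ι | p.1 ∈ E p.2} = ⋃ i, E i ×ˢ {i} := by ext; simp
    rw [this]
    exact .iUnion fun i => (hE i).prod (measurableSet_singleton i)
  have hmap := (indepFun_iff_map_prod_eq_prod_map_map hY.aemeasurable hT.aemeasurable).1 h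
  have := Measure.isProbabilityMeasure_map (μ := P) hY.aemeasurable
  have := Measure.isProbabilityMeasure_map (μ := P) hT.aemeasurable
  calc P {ω | Y ω ∈ E (T ω)}
      = P.map (fun ω => (Y ω, T ω)) {p : β × ι | p.1 ∈ E p.2} :=
        (Measure.map_apply (hY.prodMk hT) hmeas).symm
    _ = ∫⁻ i, P.map Y (E i) ∂(P.map T) := by
        rw [hmap, Measure.prod_apply_symm hmeas]; rfl
    _ = ∫⁻ ω, P.map Y (E (T ω)) ∂P :=
        lintegral_map (measurable_of_countable fun i => P.map Y (E i)) hT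
    _ = _ := lintegral_congr fun ω => Measure.map_apply hY (hE _)

end Laplace

/-! ### Approximation of times from the right by grid points. -/

section Grid

/-- The first point of the grid `{(i + 1) / (n + 1) | i : ℕ}` to the right of `s`. -/
noncomputable def gridPoint (n i : ℕ) : ℝ≥0 := (i + 1) / (n + 1)

/-- The index of the first grid point to the right of `s`. -/
noncomputable def gridIndex (n : ℕ) (s : ℝ≥0) : ℕ := ⌊(n + 1) * s⌋₊

theorem measurable_gridIndex (n : ℕ) : Measurable (gridIndex n) :=
  Nat.measurable_floor.comp (measurable_id.const_mul _)

theorem le_gridPoint_gridIndex (n : ℕ) (s : ℝ≥0) : s ≤ gridPoint n (gridIndex n s) := by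
  rw [gridPoint, le_div_iff₀ (by positivity), mul_comm]
  exact (Nat.lt_floor_add_one _).le

theorem gridPoint_gridIndex_le (n : ℕ) (s : ℝ≥0) :
    gridPoint n (gridIndex n s) ≤ s + 1 / ((n : ℝ≥0) + 1) := by
  rw [gridPoint, add_div]
  gcongr
  rw [div_le_iff₀ (by positivity), mul_comm s]
  exact Nat.floor_le zero_le

theorem tendsto_gridPoint_gridIndex (s : ℝ≥0) :
    Tendsto (fun n => gridPoint n (gridIndex n s)) atTop (𝓝[≥] s) := by
  refine tendsto_nhdsWithin_iff.2 ⟨?_, .of_forall fun n => le_gridPoint_gridIndex n s⟩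
  refine tendsto_of_tendsto_of_tendsto_of_le_of_le tendsto_const_nhds ?_
    (fun n => le_gridPoint_gridIndex n s) (fun n => gridPoint_gridIndex_le n s)
  simpa using (tendsto_one_div_add_atTop_nhds_zero_nat (𝕜 := ℝ≥0)).const_add s

end Grid

/-! ### Poisson processes evaluated at independent random times. -/

section Subordination

variable {Ω : Type*} [MeasurableSpace Ω] {P : Measure Ω}

/-- Right-continuous integer-valued paths are eventually constant along the grid approximation. The
null set does not depend on `s`, so `s` may be replaced by a random time. -/
theorem IsLevyProcess.ae_eventually_gridPoint_eq {N : ℝ≥0 → Ω → ℕ}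
    (h : IsLevyProcess (fun t ω => (N t ω : ℝ)) P) :
    ∀ᵐ ω ∂P, ∀ s, ∀ᶠ n in atTop, N (gridPoint n (gridIndex n s)) ω = N s ω := by
  filter_upwards [h.cadlag] with ω hω s
  have h1 := Nat.isClosedEmbedding_coe_real.isEmbedding.tendsto_nhds_iff.2
    ((hω s).1.tendsto.comp (tendsto_gridPoint_gridIndex s))
  rw [nhds_discrete, tendsto_pure] at h1
  exact h1

theorem measurable_eval_nat {β : Type*} [MeasurableSpace β] {f : ℕ → Ω → β}
    (hf : ∀ i, Measurable (f i)) {T : Ω → ℕ} (hT : Measurable T) :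
    Measurable fun ω => f (T ω) ω :=
  Measurable.comp (g := fun p : Ω × ℕ => f p.2 p.1) (f := fun ω => (ω, T ω))
    (measurable_from_prod_countable_left hf) (measurable_id.prodMk hT)

theorem measurable_eval_gridPoint {N : ℝ≥0 → Ω → ℕ} (hN : ∀ t, Measurable (N t))
    {T : Ω → ℝ≥0} (hT : Measurable T) (n : ℕ) :
    Measurable fun ω => N (gridPoint n (gridIndex n (T ω))) ω :=
  measurable_eval_nat (f := fun i => N (gridPoint n i)) (fun _ => hN _)
    (T := fun ω => gridIndex n (T ω)) ((measurable_gridIndex n).comp hT)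

theorem IsLevyProcess.aemeasurable_eval {N : ℝ≥0 → Ω → ℕ}
    (h : IsLevyProcess (fun t ω => (N t ω : ℝ)) P) {T : Ω → ℝ≥0} (hT : Measurable T) :
    AEMeasurable (fun ω => N (T ω) ω) P := by
  refine aemeasurable_of_tendsto_metrizable_ae atTop
    (fun n => (measurable_eval_gridPoint h.measurable_natCast hT n).aemeasurable) ?_
  filter_upwards [h.ae_eventually_gridPoint_eq] with ω hω
  exact tendsto_const_nhds.congr' ((hω (T ω)).mono fun n hn => hn.symm)

theorem continuous_poissonMeasure_singleton (k : ℕ) :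
    Continuous fun r : ℝ≥0 => poissonMeasure r {k} := by
  simp only [poissonMeasure_singleton]
  exact ENNReal.continuous_ofReal.comp (by fun_prop)

theorem measure_eval_gridPoint_eq [IsProbabilityMeasure P] {lam₁ lam₂ : ℝ}
    {N₁ N₂ : ℝ≥0 → Ω → ℕ} (hN₁ : IsPoissonProcess lam₁ N₁ P) (hN₂ : IsPoissonProcess lam₂ N₂ P)
    (hN : IndepFun (fun ω t => N₁ t ω) (fun ω t => N₂ t ω) P) {T₁ T₂ : Ω → ℝ≥0}
    (hT₁ : Measurable T₁) (hT₂ : Measurable T₂)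
    (hNT : IndepFun (fun ω => ((fun t => N₁ t ω), (fun t => N₂ t ω)))
      (fun ω => (T₁ ω, T₂ ω)) P) (a b n : ℕ) :
    P {ω | N₁ (gridPoint n (gridIndex n (T₁ ω))) ω = a ∧
        N₂ (gridPoint n (gridIndex n (T₂ ω))) ω = b} =
      ∫⁻ ω, poissonMeasure (lam₁.toNNReal * gridPoint n (gridIndex n (T₁ ω))) {a} *
        poissonMeasure (lam₂.toNNReal * gridPoint n (gridIndex n (T₂ ω))) {b} ∂P := by
  have hY₁ : Measurable fun ω t => N₁ t ω := measurable_pi_lambda _ hN₁.levy.measurable_natCast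
  have hY₂ : Measurable fun ω t => N₂ t ω := measurable_pi_lambda _ hN₂.levy.measurable_natCast
  have hg : Measurable fun p : ℝ≥0 × ℝ≥0 => (gridIndex n p.1, gridIndex n p.2) :=
    ((measurable_gridIndex n).comp measurable_fst).prodMk
      ((measurable_gridIndex n).comp measurable_snd)
  have key := measure_mem_of_indepFun (hY₁.prodMk hY₂) (hg.comp (hT₁.prodMk hT₂))
    (hNT.comp measurable_id hg)
    (E := fun i : ℕ × ℕ => {y : (ℝ≥0 → ℕ) × (ℝ≥0 → ℕ) |
      y.1 (gridPoint n i.1) = a ∧ y.2 (gridPoint n i.2) = b})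
    fun i => by
      refine MeasurableSet.inter
        (measurableSet_eq_fun ((measurable_pi_apply _).comp measurable_fst) measurable_const)
        (measurableSet_eq_fun ((measurable_pi_apply _).comp measurable_snd) measurable_const)
  refine key.trans (lintegral_congr fun ω => ?_)
  have hind := (hN.comp (measurable_pi_apply (gridPoint n (gridIndex n (T₁ ω))))
    (measurable_pi_apply (gridPoint n (gridIndex n (T₂ ω))))).measure_inter_preimage_eq_mul
      {a} {b} (measurableSet_singleton a) (measurableSet_singleton b)
  have h₁ := (hN₁.law (gridPoint n (gridIndex n (T₁ ω)))).measure_eq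
    (p := (· = a)) (measurableSet_singleton a)
  have h₂ := (hN₂.law (gridPoint n (gridIndex n (T₂ ω)))).measure_eq
    (p := (· = b)) (measurableSet_singleton b)
  exact hind.trans (congrArg₂ (· * ·) h₁ h₂)

/-- The discretised times allow conditioning; both sides then pass to the limit, by path
right-continuity on the left and dominated convergence on the right. -/
theorem measure_eval_eq [IsProbabilityMeasure P] {lam₁ lam₂ : ℝ}
    {N₁ N₂ : ℝ≥0 → Ω → ℕ} (hN₁ : IsPoissonProcess lam₁ N₁ P) (hN₂ : IsPoissonProcess lam₂ N₂ P)
    (hN : IndepFun (fun ω t => N₁ t ω) (fun ω t => N₂ t ω) P) {T₁ T₂ : Ω → ℝ≥0}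
    (hT₁ : Measurable T₁) (hT₂ : Measurable T₂) (hT : IndepFun T₁ T₂ P)
    (hNT : IndepFun (fun ω => ((fun t => N₁ t ω), (fun t => N₂ t ω)))
      (fun ω => (T₁ ω, T₂ ω)) P) (a b : ℕ) :
    P {ω | N₁ (T₁ ω) ω = a ∧ N₂ (T₂ ω) ω = b} =
      (∫⁻ ω, poissonMeasure (lam₁.toNNReal * T₁ ω) {a} ∂P) *
        ∫⁻ ω, poissonMeasure (lam₂.toNNReal * T₂ ω) {b} ∂P := by
  have hp₁ : Measurable fun r : ℝ≥0 => poissonMeasure (lam₁.toNNReal * r) {a} :=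
    ((continuous_poissonMeasure_singleton a).comp (continuous_const_mul _)).measurable
  have hp₂ : Measurable fun r : ℝ≥0 => poissonMeasure (lam₂.toNNReal * r) {b} :=
    ((continuous_poissonMeasure_singleton b).comp (continuous_const_mul _)).measurable
  refine Eq.trans ?_ (lintegral_mul_eq_lintegral_mul_lintegral_of_indepFun (hp₁.comp hT₁)
    (hp₂.comp hT₂) (hT.comp hp₁ hp₂))
  -- Right-continuity holds only almost surely, so the event is merely null-measurable and is
  -- replaced by a measurable set `A`.
  have hnull : NullMeasurableSet {ω | N₁ (T₁ ω) ω = a ∧ N₂ (T₂ ω) ω = b} P :=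
    ((hN₁.levy.aemeasurable_eval hT₁).nullMeasurable (measurableSet_singleton a)).inter
      ((hN₂.levy.aemeasurable_eval hT₂).nullMeasurable (measurableSet_singleton b))
  obtain ⟨A, hA, hAe⟩ := hnull
  have hlhs : Tendsto (fun n => P {ω | N₁ (gridPoint n (gridIndex n (T₁ ω))) ω = a ∧
      N₂ (gridPoint n (gridIndex n (T₂ ω))) ω = b}) atTop
      (𝓝 (P {ω | N₁ (T₁ ω) ω = a ∧ N₂ (T₂ ω) ω = b})) := by
    rw [measure_congr hAe]
    refine tendsto_measure_of_ae_tendsto_indicator_of_isFiniteMeasure atTop hA (fun n =>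
      (measurable_eval_gridPoint hN₁.levy.measurable_natCast hT₁ n
        (measurableSet_singleton a)).inter
      (measurable_eval_gridPoint hN₂.levy.measurable_natCast hT₂ n
        (measurableSet_singleton b))) ?_
    filter_upwards [hN₁.levy.ae_eventually_gridPoint_eq, hN₂.levy.ae_eventually_gridPoint_eq,
      hAe.mem_iff] with ω h₁ h₂ h₃
    filter_upwards [h₁ (T₁ ω), h₂ (T₂ ω)] with n e₁ e₂
    rw [← h₃, e₁, e₂]
  refine tendsto_nhds_unique (hlhs.congr fun n =>
    measure_eval_gridPoint_eq hN₁ hN₂ hN hT₁ hT₂ hNT a b n) ?_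
  have hgrid : ∀ n, Measurable fun s => gridPoint n (gridIndex n s) := fun n =>
    (measurable_of_countable (gridPoint n)).comp (measurable_gridIndex n)
  refine tendsto_lintegral_of_dominated_convergence (fun _ => 1)
    (fun n => (hp₁.comp ((hgrid n).comp hT₁)).mul (hp₂.comp ((hgrid n).comp hT₂)))
    (fun n => ae_of_all _ fun ω => mul_le_one' prob_le_one prob_le_one) (by simp)
    (ae_of_all _ fun ω => ?_)
  have hlim : ∀ (lam : ℝ≥0) (k : ℕ) (s : ℝ≥0), Tendsto (fun n =>
      poissonMeasure (lam * gridPoint n (gridIndex n s)) {k}) atTop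
      (𝓝 (poissonMeasure (lam * s) {k})) := fun lam k s =>
    ((continuous_poissonMeasure_singleton k).comp (continuous_const_mul lam)).continuousAt.tendsto.comp
      ((tendsto_gridPoint_gridIndex s).mono_right nhdsWithin_le_nhds)
  exact ENNReal.Tendsto.mul (hlim _ a _) (.inr (measure_ne_top _ _)) (hlim _ b _)
    (.inr (measure_ne_top _ _))

theorem IsTemperedStableSubordinator.toReal_lintegral_poissonMeasure [IsProbabilityMeasure P]
    {α μ : ℝ} {D : ℝ≥0 → Ω → ℝ≥0} (h : IsTemperedStableSubordinator α μ D P) (t : ℝ≥0)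
    {lam : ℝ} (hlam : 0 < lam) (n : ℕ) :
    (∫⁻ ω, poissonMeasure (lam.toNNReal * D t ω) {n} ∂P).toReal =
      (-1) ^ n / (n ! : ℝ) * Real.exp (t * μ ^ α) *
        (lam ^ n * iteratedDeriv n (stretchedExp α t) (lam + μ)) := by
  have hp : Measurable fun r : ℝ≥0 => poissonMeasure (lam.toNNReal * r) {n} :=
    ((continuous_poissonMeasure_singleton n).comp (continuous_const_mul _)).measurable
  refine (integral_toReal (hp.comp (h.measurable t)).aemeasurable
    (ae_of_all _ fun ω => measure_lt_top _ _)).symm.trans ?_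
  have e : ∀ ω, (poissonMeasure (lam.toNNReal * D t ω) {n}).toReal =
      lam ^ n / (n ! : ℝ) * ((D t ω : ℝ) ^ n * Real.exp (-lam * D t ω)) := fun ω => by
    rw [← measureReal_def, poissonMeasure_real_singleton, NNReal.coe_mul,
      Real.coe_toNNReal _ hlam.le, mul_pow, neg_mul]
    ring
  simp only [Function.comp_def, e]
  rw [integral_const_mul, h.integral_pow_mul_exp_neg t hlam]
  ring

theorem hasSum_measureReal_iUnion₀ [IsFiniteMeasure P] {A : ℕ → Set Ω}
    (hA : ∀ n, NullMeasurableSet (A n) P) (hd : Pairwise (Function.onFun Disjoint A)) :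
    HasSum (fun n => P.real (A n)) (P.real (⋃ n, A n)) := by
  have e := measure_iUnion₀ (fun i j hij => (hd hij).aedisjoint) hA
  have hfin : ∑' n, P (A n) ≠ ∞ := e ▸ measure_ne_top _ _
  have h := ENNReal.hasSum_toReal hfin
  rwa [← ENNReal.tsum_toReal_eq (ENNReal.ne_top_of_tsum_ne_top hfin), ← e] at h

end Subordination

/-! ### Joint law of the two counts and the formulas for the difference. -/

theorem measureReal_subordinated_poisson_eq {Ω : Type*} [MeasurableSpace Ω] {P : Measure Ω}
    [IsProbabilityMeasure P] {α₁ α₂ μ₁ μ₂ lam₁ lam₂ : ℝ}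
    (hα₁ : 0 < α₁ ∧ α₁ < 1) (hα₂ : 0 < α₂ ∧ α₂ < 1)
    (hμ₁ : 0 < μ₁) (hμ₂ : 0 < μ₂) (hlam₁ : 0 < lam₁) (hlam₂ : 0 < lam₂)
    {N₁ N₂ : ℝ≥0 → Ω → ℕ} {D₁ D₂ : ℝ≥0 → Ω → ℝ≥0}
    (hN₁ : IsPoissonProcess lam₁ N₁ P) (hN₂ : IsPoissonProcess lam₂ N₂ P)
    (hD₁ : IsTemperedStableSubordinator α₁ μ₁ D₁ P)
    (hD₂ : IsTemperedStableSubordinator α₂ μ₂ D₂ P)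
    (hN : IndepFun (fun ω t => N₁ t ω) (fun ω t => N₂ t ω) P)
    (hD : IndepFun (fun ω t => D₁ t ω) (fun ω t => D₂ t ω) P)
    (hND : IndepFun (fun ω => ((fun t => N₁ t ω), (fun t => N₂ t ω)))
      (fun ω => ((fun t => D₁ t ω), (fun t => D₂ t ω))) P)
    (t : ℝ≥0) (h : t = 0 ∨ (μ₁ < lam₁ ∧ μ₂ < lam₂)) (a b : ℕ) :
    P.real {ω | N₁ (D₁ t ω) ω = a ∧ N₂ (D₂ t ω) ω = b} =
      (-1 : ℝ) ^ (a + b) / ((a ! : ℝ) * (b ! : ℝ)) * Real.exp (t * (μ₁ ^ α₁ + μ₂ ^ α₂)) *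
        (∑' m : ℕ, innerTerm α₁ μ₁ lam₁ t a m) * (∑' l : ℕ, innerTerm α₂ μ₂ lam₂ t b l) := by
  have hev : Measurable fun p : (ℝ≥0 → ℝ≥0) × (ℝ≥0 → ℝ≥0) => (p.1 t, p.2 t) :=
    ((measurable_pi_apply t).comp measurable_fst).prodMk
      ((measurable_pi_apply t).comp measurable_snd)
  rw [measureReal_def, measure_eval_eq hN₁ hN₂ hN (hD₁.measurable t) (hD₂.measurable t)
    (hD.comp (measurable_pi_apply t) (measurable_pi_apply t)) (hND.comp measurable_id hev),
    ENNReal.toReal_mul, hD₁.toReal_lintegral_poissonMeasure t hlam₁,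
    hD₂.toReal_lintegral_poissonMeasure t hlam₂,
    (hasSum_innerTerm hα₁.1.le hα₁.2.le hμ₁ hlam₁
      (h.imp NNReal.coe_eq_zero.2 And.left) a).tsum_eq,
    (hasSum_innerTerm hα₂.1.le hα₂.2.le hμ₂ hlam₂
      (h.imp NNReal.coe_eq_zero.2 And.right) b).tsum_eq, mul_add, Real.exp_add, pow_add]
  ring

theorem hasSum_measureReal_sub_eq {Ω : Type*} [MeasurableSpace Ω] {P : Measure Ω}
    [IsFiniteMeasure P] {X Y : Ω → ℕ} (hX : AEMeasurable X P) (hY : AEMeasurable Y P) (a b : ℕ) :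
    HasSum (fun n => P.real {ω | X ω = n + a ∧ Y ω = n + b})
      (P.real (⋃ n, {ω | X ω = n + a ∧ Y ω = n + b})) := by
  refine hasSum_measureReal_iUnion₀ (fun n => ?_) fun i j hij => ?_
  · exact (hX.nullMeasurable (measurableSet_singleton _)).inter
      (hY.nullMeasurable (measurableSet_singleton _))
  · refine Set.disjoint_left.2 fun ω hi hj => hij ?_
    have := hi.1.symm.trans hj.1
    omega

theorem mainTheorem6 {Ω : Type*} [MeasurableSpace Ω] (P : Measure Ω) [IsProbabilityMeasure P]
    (α₁ α₂ μ₁ μ₂ lam₁ lam₂ : ℝ)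
    (hα₁ : 0 < α₁ ∧ α₁ < 1) (hα₂ : 0 < α₂ ∧ α₂ < 1)
    (hμ₁ : 0 < μ₁) (hμ₂ : 0 < μ₂) (hlam₁ : 0 < lam₁) (hlam₂ : 0 < lam₂)
    (N₁ N₂ : ℝ≥0 → Ω → ℕ) (D₁ D₂ : ℝ≥0 → Ω → ℝ≥0)
    (hN₁ : IsPoissonProcess lam₁ N₁ P) (hN₂ : IsPoissonProcess lam₂ N₂ P)
    (hD₁ : IsTemperedStableSubordinator α₁ μ₁ D₁ P)
    (hD₂ : IsTemperedStableSubordinator α₂ μ₂ D₂ P)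
    (hN : IndepFun (fun ω t => N₁ t ω) (fun ω t => N₂ t ω) P)
    (hD : IndepFun (fun ω t => D₁ t ω) (fun ω t => D₂ t ω) P)
    (hND : IndepFun (fun ω => ((fun t => N₁ t ω), (fun t => N₂ t ω)))
      (fun ω => ((fun t => D₁ t ω), (fun t => D₂ t ω))) P)
    (t : ℝ≥0) :
    -- the Fox–Wright series converge absolutely
    (∀ j m : ℕ,
      Summable (foxWrightTerm 1 α₁ (1 - (j : ℝ) - (m : ℝ)) α₁ (-lam₁ ^ α₁ * t)) ∧
      Summable (foxWrightTerm 1 α₂ (1 - (j : ℝ) - (m : ℝ)) α₂ (-lam₂ ^ α₂ * t))) ∧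
    -- the range of parameters in which the inner series converge
    (∀ j : ℕ, 2 ≤ j →
      ((∃ s, Tendsto (fun M => ∑ m ∈ Finset.range M, innerTerm α₁ μ₁ lam₁ t j m) atTop (𝓝 s)) ↔
        t = 0 ∨ μ₁ < lam₁) ∧
      ((∃ s, Tendsto (fun M => ∑ l ∈ Finset.range M, innerTerm α₂ μ₂ lam₂ t j l) atTop (𝓝 s)) ↔
        t = 0 ∨ μ₂ < lam₂)) ∧
    -- in that range the inner series converge absolutely and the formulas hold
    (t = 0 ∨ (μ₁ < lam₁ ∧ μ₂ < lam₂) →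
      (∀ j : ℕ, Summable (innerTerm α₁ μ₁ lam₁ t j) ∧ Summable (innerTerm α₂ μ₂ lam₂ t j)) ∧
      ∀ k : ℤ,
        (0 ≤ k →
          HasSum
            (fun n : ℕ =>
              (-1 : ℝ) ^ k.natAbs / ((n ! : ℝ) * ((n + k.natAbs)! : ℝ)) *
                Real.exp (t * (μ₁ ^ α₁ + μ₂ ^ α₂)) *
                (∑' m : ℕ, innerTerm α₁ μ₁ lam₁ t (n + k.natAbs) m) *
                (∑' l : ℕ, innerTerm α₂ μ₂ lam₂ t n l))
            (P.real {ω | tsfsp N₁ N₂ D₁ D₂ t ω = k})) ∧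
        (k < 0 →
          HasSum
            (fun n : ℕ =>
              (-1 : ℝ) ^ k.natAbs / ((n ! : ℝ) * ((n + k.natAbs)! : ℝ)) *
                Real.exp (t * (μ₁ ^ α₁ + μ₂ ^ α₂)) *
                (∑' m : ℕ, innerTerm α₁ μ₁ lam₁ t n m) *
                (∑' l : ℕ, innerTerm α₂ μ₂ lam₂ t (n + k.natAbs) l))
            (P.real {ω | tsfsp N₁ N₂ D₁ D₂ t ω = k}))) := by

  have hX₁ := hN₁.levy.aemeasurable_eval (hD₁.measurable t)
  have hX₂ := hN₂.levy.aemeasurable_eval (hD₂.measurable t)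
  refine ⟨fun j m => ⟨summable_foxWrightTerm hα₁.1.le hα₁.2.le t j m hlam₁,
    summable_foxWrightTerm hα₂.1.le hα₂.2.le t j m hlam₂⟩, fun j hj => ⟨?_, ?_⟩, fun h =>
    ⟨fun j => ⟨(hasSum_innerTerm hα₁.1.le hα₁.2.le hμ₁ hlam₁
        (h.imp NNReal.coe_eq_zero.2 And.left) j).summable,
      (hasSum_innerTerm hα₂.1.le hα₂.2.le hμ₂ hlam₂
        (h.imp NNReal.coe_eq_zero.2 And.right) j).summable⟩, fun k => ⟨fun hk => ?_, fun hk => ?_⟩⟩⟩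
  · rw [exists_tendsto_sum_innerTerm_iff hα₁.1 hα₁.2 hμ₁ hlam₁ t.coe_nonneg hj, NNReal.coe_eq_zero]
  · rw [exists_tendsto_sum_innerTerm_iff hα₂.1 hα₂.2 hμ₂ hlam₂ t.coe_nonneg hj, NNReal.coe_eq_zero]
  -- For `k ≥ 0` the smaller count is the second one, which serves as the index `n`.
  · have hset : {ω | tsfsp N₁ N₂ D₁ D₂ t ω = k} =
        ⋃ n : ℕ, {ω | N₁ (D₁ t ω) ω = n + k.natAbs ∧ N₂ (D₂ t ω) ω = n + 0} := by
      ext ω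
      simp only [tsfsp, Set.mem_ofPred_eq, Set.mem_iUnion]
      exact ⟨fun e => ⟨N₂ (D₂ t ω) ω, by omega, by omega⟩, fun ⟨n, e₁, e₂⟩ => by omega⟩
    rw [hset]
    refine (hasSum_measureReal_sub_eq hX₁ hX₂ k.natAbs 0).congr_fun fun n => ?_
    rw [measureReal_subordinated_poisson_eq hα₁ hα₂ hμ₁ hμ₂ hlam₁ hlam₂ hN₁ hN₂ hD₁ hD₂ hN hD hND
      t h, add_zero, show n + k.natAbs + n = 2 * n + k.natAbs by ring, pow_add,
      (even_two_mul n).neg_one_pow, one_mul, mul_comm (n ! : ℝ)]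
  · have hset : {ω | tsfsp N₁ N₂ D₁ D₂ t ω = k} =
        ⋃ n : ℕ, {ω | N₁ (D₁ t ω) ω = n + 0 ∧ N₂ (D₂ t ω) ω = n + k.natAbs} := by
      ext ω
      simp only [tsfsp, Set.mem_ofPred_eq, Set.mem_iUnion]
      exact ⟨fun e => ⟨N₁ (D₁ t ω) ω, by omega, by omega⟩, fun ⟨n, e₁, e₂⟩ => by omega⟩
    rw [hset]
    refine (hasSum_measureReal_sub_eq hX₁ hX₂ 0 k.natAbs).congr_fun fun n => ?_
    rw [measureReal_subordinated_poisson_eq hα₁ hα₂ hμ₁ hμ₂ hlam₁ hlam₂ hN₁ hN₂ hD₁ hD₂ hN hD hND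
      t h, add_zero, show n + (n + k.natAbs) = 2 * n + k.natAbs by ring, pow_add,
      (even_two_mul n).neg_one_pow, one_mul]
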